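/- Let $\mathbf{S}_1$ be the monoid presented by $$\langle a,b,t,x,y \mid at^nb \Rightarrow 1\ (n\in\mathbb{N}),\ xa\Rightarrow atx,\ xt\Rightarrow tx,\ xb\Rightarrow bx,\ xy\Rightarrow 1\rangle,$$ where $\mathbb{N}$ contains $0$. That is, $\mathbf{S}_1$ is the quotient of the free monoid on $\{a,b,t,x,y\}$ by the congruence generated by these relations. A presentation of a monoid $M$ is a set $\Sigma_1$ of generators with a family $\Sigma_2$ of rules $u\Rightarrow v$ between words of the free monoid $\Sigma_1^*$, such that the quotient of $\Sigma_1^*$ by the congruence generated by the rules is isomorphic to $M$. It is finite if $\Sigma_1$ and $\Sigma_2$ are finite. A rewriting step is $puq\Rightarrow pvq$ with $u\Rightarrow v$ in $\Sigma_2$ and $p,q\in\Sigma_1^*$. The presentation is convergent if it terminates (there is no infinite sequence of rewriting steps) and is confluent (any two words obtained from a common word by finitely many rewriting steps can both be rewritten, in finitely many steps, into a common word). Then: 1. $\mathbf{S}_1$ has a finite presentation; 2. $\mathbf{S}_1$ has a decidable word problem: there are a finite set $\Sigma_1$, a surjective morphism $\pi:\Sigma_1^*\to\mathbf{S}_1$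 and an algorithm that decides, for any two words $u,v\in\Sigma_1^*$, whether $\pi(u)=\pi(v)$; 3. no finite presentation of $\mathbf{S}_1$, over any finite set of generators, is convergent. -/

import Mathlib

universe u v

/-- A presentation of a monoid by generators and oriented relations (a string rewriting system, or
a 2-polygraph with a single 0-cell): each element `r` of `Rule` is a rewriting rule
`src r ⇒ tgt r` between words over `Gen`. -/
structure MonoidPresentation where
  /-- the generators -/
  Gen : Type u
  /-- the (names of the) relations -/
  Rule : Type v
  /-- the source of a relation -/
  src : Rule → FreeMonoid Gen
  /-- the target of a relation -/
  tgt : Rule → FreeMonoid Gen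

namespace MonoidPresentation

/-- The relation on words consisting of all pairs `(src r, tgt r)`. -/
def Rel (P : MonoidPresentation.{u, v}) (w w' : FreeMonoid P.Gen) : Prop :=
  ∃ r : P.Rule, P.src r = w ∧ P.tgt r = w'

/-- The monoid presented by `P`: the free monoid on the generators modulo the congruence generated
by the relations. -/
abbrev Presented (P : MonoidPresentation.{u, v}) : Type u :=
  PresentedMonoid P.Rel

/-- `P` is a presentation of the monoid `M`. -/
def Presents (P : MonoidPresentation.{u, v}) (M : Type*) [Monoid M] : Prop :=
  Nonempty (P.Presented ≃* M)

/-- `P` has finitely many generators and finitely many relations. -/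
def IsFinite (P : MonoidPresentation.{u, v}) : Prop :=
  Finite P.Gen ∧ Finite P.Rule

/-- There is a rewriting step `p (src r) q ⇒ p (tgt r) q` from `w` to `w'`. -/
def Step (P : MonoidPresentation.{u, v}) (w w' : FreeMonoid P.Gen) : Prop :=
  ∃ (p q : FreeMonoid P.Gen) (r : P.Rule), w = p * P.src r * q ∧ w' = p * P.tgt r * q

/-- `w` rewrites into `w'` in finitely many (possibly zero) steps. -/
def Rewrites (P : MonoidPresentation.{u, v}) : FreeMonoid P.Gen → FreeMonoid P.Gen → Prop :=
  Relation.ReflTransGen P.Step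

/-- There is no infinite rewriting sequence. -/
def Terminates (P : MonoidPresentation.{u, v}) : Prop :=
  ¬ ∃ w : ℕ → FreeMonoid P.Gen, ∀ n, P.Step (w n) (w (n + 1))

/-- Any two words obtained by rewriting a common word rewrite into a common word. -/
def Confluent (P : MonoidPresentation.{u, v}) : Prop :=
  ∀ w w₁ w₂ : FreeMonoid P.Gen, P.Rewrites w w₁ → P.Rewrites w w₂ →
    ∃ w', P.Rewrites w₁ w' ∧ P.Rewrites w₂ w'

/-- A presentation is convergent if it terminates and is confluent. -/
def Convergent (P : MonoidPresentation.{u, v}) : Prop :=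
  P.Terminates ∧ P.Confluent

end MonoidPresentation

/-- `M` admits a presentation with finitely many generators and finitely many relations. -/
def MonoidFinitelyPresented (M : Type*) [Monoid M] : Prop :=
  ∃ P : MonoidPresentation.{0, 0}, P.IsFinite ∧ P.Presents M

/-- `M` has a decidable word problem: there is a finite generating family, given as a surjective
morphism from a free monoid on `n` letters, for which it is decidable by an algorithm whether two
words represent the same element of `M`. -/
def HasDecidableWordProblem (M : Type*) [Monoid M] : Prop :=
  ∃ (n : ℕ) (π : FreeMonoid (Fin n) →* M), Function.Surjective π ∧
    ComputablePred fun p : List (Fin n) × List (Fin n) =>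
      π (FreeMonoid.ofList p.1) = π (FreeMonoid.ofList p.2)

/-- The five generators of Squier's monoid. -/
inductive SquierGen : Type
  | a | b | t | x | y

/-- The names of the relations of Squier's monoid. -/
inductive SquierRule : Type
  | alpha (n : ℕ) | beta | gamma | delta | epsilon

namespace Squier

/-- The generator `a` as a word. -/
abbrev a : FreeMonoid SquierGen := FreeMonoid.of SquierGen.a
/-- The generator `b` as a word. -/
abbrev b : FreeMonoid SquierGen := FreeMonoid.of SquierGen.b
/-- The generator `t` as a word. -/
abbrev t : FreeMonoid SquierGen := FreeMonoid.of SquierGen.t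
/-- The generator `x` as a word. -/
abbrev x : FreeMonoid SquierGen := FreeMonoid.of SquierGen.x
/-- The generator `y` as a word. -/
abbrev y : FreeMonoid SquierGen := FreeMonoid.of SquierGen.y

/-- The sources of the relations. -/
def src : SquierRule → FreeMonoid SquierGen
  | .alpha n => a * t ^ n * b
  | .beta => x * a
  | .gamma => x * t
  | .delta => x * b
  | .epsilon => x * y

/-- The targets of the relations. -/
def tgt : SquierRule → FreeMonoid SquierGen
  | .alpha _ => 1
  | .beta => a * t * x
  | .gamma => t * x
  | .delta => b * x
  | .epsilon => 1

/-- The infinite presentation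
`⟨a, b, t, x, y | a tⁿ b ⇒ 1 (n ∈ ℕ), x a ⇒ a t x, x t ⇒ t x, x b ⇒ b x, x y ⇒ 1⟩`. -/
def Sq : MonoidPresentation.{0, 0} where
  Gen := SquierGen
  Rule := SquierRule
  src := src
  tgt := tgt

end Squier

/-- Squier's monoid `S₁`. -/
abbrev SquierMonoid : Type := Squier.Sq.Presented

/-! Reading words with a stack machine computes normal forms, which settles the word problem
(`toMonoid_eq_iff`). Conjugating `a tⁿ b = 1` by `x` and `y` yields `a tⁿ⁺¹ b = 1`, so `a b = 1` is
the only relation of its family that a finite presentation needs.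

Non-convergence is a homological finiteness argument. Give `a tⁿ b ⇒ 1` the weight `e₋ₙ` in `ℤ → ℤ`
and the other rules weight `0`, with `x` and `y` acting on the right as mutually inverse shifts.
These weights derive from a potential on words. Cut the sequences off below `-N`: `x` now prepends a
zero, `y` drops a term, and `x y = 1` still holds. Since the sequences involved vanish near `-∞`,
any finite set of identities survives truncation for large `N`.

For a finite convergent presentation, transport the weights and truncate. Its critical branchings
are among finitely many bounded ones, so for large `N` all are consistent, and termination gives a
truncated potential (`exists_isPotential`). Back over the five generators, the branchings `x a tⁿ b`
force `zₙ = prepend zₙ₊₁` for the corrected weights `zₙ` of `a tⁿ b ⇒ 1`. Hence every `zₙ` vanishes,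
while `z₀` is the truncation of `e₀`, which is nonzero (`not_isEquivariant`). -/

/-- **Newman's lemma**: a terminating, locally confluent relation is confluent. -/
theorem Relation.join_of_locallyConfluent {α : Type*} {r : α → α → Prop}
    (wf : WellFounded (flip r))
    (h : ∀ a b c, r a b → r a c → Relation.Join (Relation.ReflTransGen r) b c) (a b c : α)
    (hb : Relation.ReflTransGen r a b) (hc : Relation.ReflTransGen r a c) :
    Relation.Join (Relation.ReflTransGen r) b c := by
  induction a using wf.induction generalizing b c with
  | _ a ih =>
    rcases hb.cases_head with rfl | ⟨b', hab', hb'⟩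
    · exact ⟨c, hc, .refl⟩
    rcases hc.cases_head with rfl | ⟨c', hac', hc'⟩
    · exact ⟨b, .refl, hb⟩
    obtain ⟨d, hbd, hcd⟩ := h a b' c' hab' hac'
    obtain ⟨e, hbe, hde⟩ := ih b' hab' b d hb' hbd
    obtain ⟨f, hcf, hef⟩ := ih c' hac' c e hc' (hcd.trans hde)
    exact ⟨f, hbe.trans hef, hcf⟩

theorem FreeMonoid.mul_eq_mul_cases {α : Type*} {p q p' q' : FreeMonoid α}
    (h : p * q = p' * q') :
    (∃ s, p' = p * s ∧ q = s * q') ∨ (∃ s, p = p' * s ∧ q' = s * q) :=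
  List.append_eq_append_iff.1 h

/-! ### Weighted rewriting steps and potentials -/

namespace MonoidPresentation

variable {P : MonoidPresentation.{u, v}} {D : Type*} [AddCommGroup D]

theorem Step.context {w w' : FreeMonoid P.Gen} (h : P.Step w w') (p q : FreeMonoid P.Gen) :
    P.Step (p * w * q) (p * w' * q) := by
  obtain ⟨p', q', r, rfl, rfl⟩ := h
  exact ⟨p * p', q' * q, r, by simp only [mul_assoc], by simp only [mul_assoc]⟩

theorem eqvGen_step_context {w w' : FreeMonoid P.Gen} (h : Relation.EqvGen P.Step w w')
    (p q : FreeMonoid P.Gen) : Relation.EqvGen P.Step (p * w * q) (p * w' * q) := by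
  induction h with
  | rel _ _ h => exact .rel _ _ (h.context p q)
  | refl _ => exact .refl _
  | symm _ _ _ ih => exact .symm _ _ ih
  | trans _ _ _ _ _ ih ih' => exact .trans _ _ _ ih ih'

theorem mk_src_eq_mk_tgt (r : P.Rule) :
    PresentedMonoid.mk P.Rel (P.src r) = PresentedMonoid.mk P.Rel (P.tgt r) :=
  PresentedMonoid.mk_eq_mk_of_rel ⟨r, rfl, rfl⟩

theorem eqvGen_step_of_mk_eq {w w' : FreeMonoid P.Gen}
    (h : PresentedMonoid.mk P.Rel w = PresentedMonoid.mk P.Rel w') :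
    Relation.EqvGen P.Step w w' := by
  have h' : ConGen.Rel P.Rel w w' := PresentedMonoid.mk_eq_mk_iff.1 h
  clear h
  induction h' with
  | of _ _ h =>
    obtain ⟨r, rfl, rfl⟩ := h
    exact .rel _ _ ⟨1, 1, r, by simp, by simp⟩
  | refl _ => exact .refl _
  | symm _ ih => exact .symm _ _ ih
  | trans _ _ ih ih' => exact .trans _ _ _ ih ih'
  | @mul w x y z _ _ ih ih' =>
    have h₁ := eqvGen_step_context ih 1 y
    have h₂ := eqvGen_step_context ih' x 1
    simp only [one_mul, mul_one] at h₁ h₂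
    exact .trans _ _ _ h₁ h₂

/-- Rewriting steps accumulating weights: a step `p (src r) q ⇒ p (tgt r) q` adds `ω r` acted
upon by `q`. -/
def WeightStep (P : MonoidPresentation.{u, v}) (ρ : FreeMonoid P.Gen →* (AddMonoid.End D)ᵐᵒᵖ)
    (ω : P.Rule → D) (z z' : FreeMonoid P.Gen × D) : Prop :=
  ∃ (p q : FreeMonoid P.Gen) (r : P.Rule), z.1 = p * P.src r * q ∧ z'.1 = p * P.tgt r * q ∧
    z'.2 = z.2 + (ρ q).unop (ω r)

/-- A function on words whose variation along each rewriting step is the weight of the step. -/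
def IsPotential (P : MonoidPresentation.{u, v}) (ρ : FreeMonoid P.Gen →* (AddMonoid.End D)ᵐᵒᵖ)
    (ω : P.Rule → D) (Ψ : FreeMonoid P.Gen → D) : Prop :=
  ∀ (p q : FreeMonoid P.Gen) (r : P.Rule),
    Ψ (p * P.src r * q) - Ψ (p * P.tgt r * q) = (ρ q).unop (ω r)

variable {ρ : FreeMonoid P.Gen →* (AddMonoid.End D)ᵐᵒᵖ} {ω : P.Rule → D}

theorem unop_map_mul {N : Type*} [Monoid N] {ρ : N →* (AddMonoid.End D)ᵐᵒᵖ} (p q : N) (d : D) :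
    (ρ (p * q)).unop d = (ρ q).unop ((ρ p).unop d) := by
  simp

theorem WeightStep.context {z z' : FreeMonoid P.Gen × D} (h : P.WeightStep ρ ω z z')
    (p q : FreeMonoid P.Gen) (c : D) :
    P.WeightStep ρ ω (p * z.1 * q, c + (ρ q).unop z.2) (p * z'.1 * q, c + (ρ q).unop z'.2) := by
  obtain ⟨p', q', r, h₁, h₂, h₃⟩ := h
  refine ⟨p * p', q' * q, r, ?_, ?_, ?_⟩
  · simp only [h₁, mul_assoc]
  · simp only [h₂, mul_assoc]
  · simp only [h₃, unop_map_mul, map_add, add_assoc]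

theorem reflTransGen_weightStep_context {z z' : FreeMonoid P.Gen × D}
    (h : Relation.ReflTransGen (P.WeightStep ρ ω) z z') (p q : FreeMonoid P.Gen) (c : D) :
    Relation.ReflTransGen (P.WeightStep ρ ω)
      (p * z.1 * q, c + (ρ q).unop z.2) (p * z'.1 * q, c + (ρ q).unop z'.2) :=
  h.lift (fun z => (p * z.1 * q, c + (ρ q).unop z.2)) fun _ _ h => h.context p q c

theorem join_weightStep_context {z z' : FreeMonoid P.Gen × D}
    (h : Relation.Join (Relation.ReflTransGen (P.WeightStep ρ ω)) z z') (p q : FreeMonoid P.Gen)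
    (c : D) :
    Relation.Join (Relation.ReflTransGen (P.WeightStep ρ ω))
      (p * z.1 * q, c + (ρ q).unop z.2) (p * z'.1 * q, c + (ρ q).unop z'.2) := by
  obtain ⟨y, h₁, h₂⟩ := h
  exact ⟨_, reflTransGen_weightStep_context h₁ p q c, reflTransGen_weightStep_context h₂ p q c⟩

theorem Terminates.wellFounded (h : P.Terminates) : WellFounded (flip P.Step) := by
  rw [wellFounded_iff_isEmpty_descending_chain]
  exact ⟨fun f => h ⟨f.1, f.2⟩⟩

/-- The critical branchings of `P` made of two rules whose sources have length at most `L` can be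
resolved without changing the accumulated weight. -/
def CriticallyConsistent (P : MonoidPresentation.{u, v})
    (ρ : FreeMonoid P.Gen →* (AddMonoid.End D)ᵐᵒᵖ) (ω : P.Rule → D) (L : ℕ) : Prop :=
  ∀ (p q p' q' : FreeMonoid P.Gen) (r r' : P.Rule),
    p.length ≤ L → q.length ≤ L → p'.length ≤ L → q'.length ≤ L →
    p * P.src r * q = p' * P.src r' * q' →
    Relation.Join (Relation.ReflTransGen (P.WeightStep ρ ω))
      (p * P.tgt r * q, (ρ q).unop (ω r)) (p' * P.tgt r' * q', (ρ q').unop (ω r'))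

/-- The critical pair lemma with weights. Disjoint redexes commute because a rule's two sides act
alike, so each weight is unaffected by the other step. Inclusions and overlaps are a critical
branching placed in a context. -/
theorem CriticallyConsistent.join_of_prefix {L : ℕ} (hcrit : P.CriticallyConsistent ρ ω L)
    (hρ : ∀ r, ρ (P.src r) = ρ (P.tgt r)) (hL : ∀ r, (P.src r).length ≤ L)
    {p q s q' : FreeMonoid P.Gen} {r r' : P.Rule} (d : D)
    (h : P.src r * q = s * (P.src r' * q')) :
    Relation.Join (Relation.ReflTransGen (P.WeightStep ρ ω))
      (p * P.tgt r * q, d + (ρ q).unop (ω r))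
      (p * s * P.tgt r' * q', d + (ρ q').unop (ω r')) := by
  rcases FreeMonoid.mul_eq_mul_cases h with ⟨k, rfl, rfl⟩ | ⟨k, hs, hq⟩
  -- Disjoint redexes.
  · refine ⟨(p * P.tgt r * k * P.tgt r' * q',
      d + (ρ (k * P.src r' * q')).unop (ω r) + (ρ q').unop (ω r')), .single ?_, .single ?_⟩
    · exact ⟨p * P.tgt r * k, q', r', by simp only [mul_assoc], by simp only, by
        simp only [mul_assoc]⟩
    · refine ⟨p, k * P.tgt r' * q', r, by simp only [mul_assoc], by simp only [mul_assoc], ?_⟩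
      simp only [map_mul, hρ]
      abel
  rcases FreeMonoid.mul_eq_mul_cases hq with ⟨m, rfl, rfl⟩ | ⟨m, hs', rfl⟩
  -- The source of `r'` lies inside that of `r`.
  · have hlen := hL r
    rw [hs] at hlen
    simp only [FreeMonoid.length_mul] at hlen
    have key := hcrit 1 1 s m r r' (by simp) (by simp) (by omega) (by omega)
      (by rw [hs]; simp only [one_mul, mul_one, mul_assoc])
    simpa only [one_mul, mul_one, mul_assoc, map_one, MulOpposite.unop_one, AddMonoid.End.one_apply,
      unop_map_mul] using join_weightStep_context key p q d
  -- Proper overlap: `m` is the part of the source of `r'` sticking out.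
  · have hlen := hL r
    have hlen' := hL r'
    rw [hs] at hlen
    rw [hs'] at hlen'
    simp only [FreeMonoid.length_mul] at hlen hlen'
    have key := hcrit 1 m s 1 r r' (by simp) (by omega) (by omega) (by simp)
      (by rw [hs, hs']; simp only [one_mul, mul_one, mul_assoc])
    simpa only [one_mul, mul_one, mul_assoc, map_one, MulOpposite.unop_one, AddMonoid.End.one_apply,
      unop_map_mul] using join_weightStep_context key p q' d

theorem CriticallyConsistent.locallyConfluent {L : ℕ} (hcrit : P.CriticallyConsistent ρ ω L)
    (hρ : ∀ r, ρ (P.src r) = ρ (P.tgt r)) (hL : ∀ r, (P.src r).length ≤ L)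
    (z y y' : FreeMonoid P.Gen × D) (h : P.WeightStep ρ ω z y) (h' : P.WeightStep ρ ω z y') :
    Relation.Join (Relation.ReflTransGen (P.WeightStep ρ ω)) y y' := by
  obtain ⟨w, d⟩ := z
  obtain ⟨v, e⟩ := y
  obtain ⟨v', e'⟩ := y'
  obtain ⟨p, q, r, rfl, rfl, rfl⟩ := h
  obtain ⟨p', q', r', hw, rfl, rfl⟩ := h'
  simp only at hw ⊢
  simp only [mul_assoc p, mul_assoc p'] at hw
  rcases FreeMonoid.mul_eq_mul_cases hw with ⟨s, rfl, hs⟩ | ⟨s, rfl, hs⟩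
  · exact hcrit.join_of_prefix hρ hL d hs
  · obtain ⟨y, h₁, h₂⟩ := hcrit.join_of_prefix (p := p') hρ hL d hs
    exact ⟨y, h₂, h₁⟩

/-- If `P` terminates and the weights are consistent on critical branchings, then they derive from
a potential. -/
theorem exists_isPotential (hP : P.Terminates) (hρ : ∀ r, ρ (P.src r) = ρ (P.tgt r)) {L : ℕ}
    (hL : ∀ r, (P.src r).length ≤ L) (hcrit : P.CriticallyConsistent ρ ω L) :
    ∃ Ψ, P.IsPotential ρ ω Ψ := by
  have wf : WellFounded (flip (P.WeightStep ρ ω)) := by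
    refine Subrelation.wf (r := InvImage (flip P.Step) Prod.fst) ?_ (InvImage.wf _ hP.wellFounded)
    rintro z z' ⟨p, q, r, h₁, h₂, -⟩
    exact ⟨p, q, r, h₁, h₂⟩
  have hconf := Relation.join_of_locallyConfluent wf (hcrit.locallyConfluent hρ hL)
  have hnf : ∀ z : FreeMonoid P.Gen × D, ∃ y, Relation.ReflTransGen (P.WeightStep ρ ω) z y ∧
      ∀ y', ¬ P.WeightStep ρ ω y y' := by
    intro z
    induction z using wf.induction with
    | _ z ih =>
      by_cases h : ∃ y, P.WeightStep ρ ω z y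
      · obtain ⟨y, hy⟩ := h
        obtain ⟨y', h₁, h₂⟩ := ih y hy
        exact ⟨y', .head hy h₁, h₂⟩
      · exact ⟨z, .refl, not_exists.1 h⟩
  -- The potential of a word is the weight accumulated on the way to its normal form. Confluence is
  -- used on pairs (word, weight), so this weight is independent of the path.
  choose nf hnf₁ hnf₂ using fun w : FreeMonoid P.Gen => hnf (w, 0)
  refine ⟨fun w => (nf w).2, fun p q r => ?_⟩
  have h₁ : Relation.ReflTransGen (P.WeightStep ρ ω) (p * P.src r * q, 0)
      ((nf (p * P.tgt r * q)).1, (ρ q).unop (ω r) + (nf (p * P.tgt r * q)).2) := by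
    refine .head (b := (p * P.tgt r * q, (ρ q).unop (ω r))) ⟨p, q, r, rfl, rfl, by simp⟩ ?_
    simpa using reflTransGen_weightStep_context (hnf₁ (p * P.tgt r * q)) 1 1 ((ρ q).unop (ω r))
  obtain ⟨y, hy₁, hy₂⟩ := hconf _ _ _ (hnf₁ (p * P.src r * q)) h₁
  have e₁ : nf (p * P.src r * q) = y :=
    hy₁.cases_head.resolve_right fun ⟨c, hc, _⟩ => hnf₂ _ c hc
  have e₂ : ((nf (p * P.tgt r * q)).1, (ρ q).unop (ω r) + (nf (p * P.tgt r * q)).2) = y := by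
    refine hy₂.cases_head.resolve_right ?_
    rintro ⟨c, ⟨p', q', r', h₁, -, -⟩, -⟩
    exact hnf₂ (p * P.tgt r * q) (p' * P.tgt r' * q', _) ⟨p', q', r', h₁, rfl, rfl⟩
  simp only [e₁, ← e₂, add_sub_cancel_right]

/-- The left context never enters a step's weight, and the right one enters by an additive action;
hence the rule for single steps extends to zigzags. -/
theorem IsPotential.sub_eq {Ψ : FreeMonoid P.Gen → D} (hΨ : P.IsPotential ρ ω Ψ)
    {w w' : FreeMonoid P.Gen}
    (h : PresentedMonoid.mk P.Rel w = PresentedMonoid.mk P.Rel w') (p q : FreeMonoid P.Gen) :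
    Ψ (p * w * q) - Ψ (p * w' * q) = (ρ q).unop (Ψ w - Ψ w') := by
  have h' := eqvGen_step_of_mk_eq h
  clear h
  induction h' with
  | rel _ _ h =>
    obtain ⟨p', q', r, rfl, rfl⟩ := h
    rw [hΨ p' q' r, ← unop_map_mul, ← hΨ (p * p') (q' * q) r]
    simp only [mul_assoc]
  | refl _ => simp
  | symm _ _ _ ih => rw [← neg_sub, ih, ← map_neg, neg_sub]
  | trans _ _ _ _ _ ih ih' =>
    rw [← sub_add_sub_cancel, ih, ih', ← map_add, sub_add_sub_cancel]

end MonoidPresentation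

/-! ### A stack machine computing normal forms -/

namespace Squier

/-- The states of a stack machine reading words from left to right. The state `(l, k)` stands for
the word `stackWord l * x ^ k`, a normal form. -/
abbrev State : Type := List (ℕ × ℕ) × ℕ

/-- Append the letter `t` to a stack. -/
def pushT : List (ℕ × ℕ) → List (ℕ × ℕ)
  -- The code `3` is an empty letter, carrying the `t`s at the very beginning of a word.
  | [] => [(3, 1)]
  | c :: l => (c.1, c.2 + 1) :: l

/-- Append the letter `b` to a stack, erasing a factor `a tⁿ b`. -/
def pushB : List (ℕ × ℕ) → List (ℕ × ℕ)
  | [] => [(1, 0)]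
  | c :: l => if c.1 = 0 then l else (1, 0) :: c :: l

/-- The transition function of the machine. -/
def step (s : State) : SquierGen → State
  | .a => ((0, s.2) :: s.1, s.2)
  | .b => (pushB s.1, s.2)
  | .t => (pushT s.1, s.2)
  | .x => (s.1, s.2 + 1)
  | .y => if s.2 = 0 then ((2, 0) :: s.1, 0) else (s.1, s.2 - 1)

/-- The state reached from `s` by reading the word `w`. -/
def run (s : State) (w : FreeMonoid SquierGen) : State :=
  w.toList.foldl step s

@[simp] theorem run_one (s : State) : run s 1 = s := rfl

@[simp] theorem run_of (s : State) (g : SquierGen) : run s (FreeMonoid.of g) = step s g := rfl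

@[simp] theorem run_mul (s : State) (u v : FreeMonoid SquierGen) :
    run s (u * v) = run (run s u) v := by
  simp [run]

theorem run_t_pow (c : ℕ × ℕ) (l : List (ℕ × ℕ)) (k n : ℕ) :
    run (c :: l, k) (t ^ n) = ((c.1, c.2 + n) :: l, k) := by
  induction n with
  | zero => rfl
  | succ n ih => rw [pow_succ, run_mul, ih]; rfl

theorem run_src (s : State) (r : SquierRule) : run s (src r) = run s (tgt r) := by
  cases r with
  | alpha n => simp [src, tgt, step, run_t_pow, pushB]
  | beta => simp [src, tgt, step, pushT]
  | gamma => simp [src, tgt, step]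
  | delta => simp [src, tgt, step]
  | epsilon => simp [src, tgt, step]

theorem run_eq_of_mk_eq {u v : FreeMonoid SquierGen}
    (h : PresentedMonoid.mk Sq.Rel u = PresentedMonoid.mk Sq.Rel v) (s : State) :
    run s u = run s v := by
  have h' := MonoidPresentation.eqvGen_step_of_mk_eq h
  clear h
  induction h' with
  | rel _ _ h =>
    obtain ⟨p, q, r, rfl, rfl⟩ := h
    exact (run_mul _ _ _).trans ((congrArg (run · q) ((run_mul _ _ _).trans
      ((run_src _ r).trans (run_mul _ _ _).symm))).trans (run_mul _ _ _).symm)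
  | refl _ => rfl
  | symm _ _ _ ih => exact ih.symm
  | trans _ _ _ _ _ ih ih' => exact ih.trans ih'

/-- The letter of a stack entry. -/
def letter : ℕ → FreeMonoid SquierGen
  | 0 => a
  | 1 => b
  | 2 => y
  | _ => 1

/-- The word stored in a stack. -/
def stackWord : List (ℕ × ℕ) → FreeMonoid SquierGen
  | [] => 1
  | c :: l => stackWord l * letter c.1 * t ^ c.2

/-- The normal form stored in a state. -/
def stateWord (s : State) : FreeMonoid SquierGen :=
  stackWord s.1 * x ^ s.2

/-- The projection of words onto Squier's monoid. -/
abbrev toMonoid : FreeMonoid SquierGen →* SquierMonoid := PresentedMonoid.mk Sq.Rel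

theorem toMonoid_src (r : SquierRule) : toMonoid (src r) = toMonoid (tgt r) :=
  MonoidPresentation.mk_src_eq_mk_tgt (P := Sq) r

theorem toMonoid_alpha (n : ℕ) : toMonoid a * toMonoid t ^ n * toMonoid b = 1 := by
  simpa only [map_mul, map_pow, map_one, src, tgt] using toMonoid_src (.alpha n)

theorem toMonoid_beta : toMonoid x * toMonoid a = toMonoid a * toMonoid t * toMonoid x := by
  simpa only [map_mul, src, tgt] using toMonoid_src .beta

theorem toMonoid_gamma : toMonoid x * toMonoid t = toMonoid t * toMonoid x := by
  simpa only [map_mul, src, tgt] using toMonoid_src .gamma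

theorem toMonoid_delta : toMonoid x * toMonoid b = toMonoid b * toMonoid x := by
  simpa only [map_mul, src, tgt] using toMonoid_src .delta

theorem toMonoid_epsilon : toMonoid x * toMonoid y = 1 := by
  simpa only [map_mul, map_one, src, tgt] using toMonoid_src .epsilon

theorem toMonoid_x_pow_a (k : ℕ) :
    toMonoid x ^ k * toMonoid a = toMonoid a * toMonoid t ^ k * toMonoid x ^ k := by
  induction k with
  | zero => simp
  | succ k ih =>
    have hc : toMonoid x * toMonoid t ^ k = toMonoid t ^ k * toMonoid x :=
      (show Commute (toMonoid x) (toMonoid t) from toMonoid_gamma).pow_right k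
    rw [pow_succ', mul_assoc, ih, ← mul_assoc, ← mul_assoc, toMonoid_beta,
      mul_assoc (toMonoid a * toMonoid t), hc, pow_succ']
    simp only [mul_assoc]

theorem toMonoid_stateWord_step (s : State) (g : SquierGen) :
    toMonoid (stateWord (step s g)) = toMonoid (stateWord s) * toMonoid (FreeMonoid.of g) := by
  obtain ⟨l, k⟩ := s
  have ht : toMonoid x ^ k * toMonoid t = toMonoid t * toMonoid x ^ k :=
    (show Commute (toMonoid x) (toMonoid t) from toMonoid_gamma).pow_left k
  have hb : toMonoid x ^ k * toMonoid b = toMonoid b * toMonoid x ^ k :=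
    (show Commute (toMonoid x) (toMonoid b) from toMonoid_delta).pow_left k
  cases g with
  | a =>
    simp only [step, stateWord, stackWord, letter, map_mul, map_pow]
    rw [mul_assoc _ (toMonoid x ^ k), toMonoid_x_pow_a]
    simp only [mul_assoc]
  | b =>
    simp only [step, stateWord, map_mul, map_pow]
    rw [mul_assoc _ (toMonoid x ^ k), hb, ← mul_assoc]
    congr 1
    rcases l with - | ⟨⟨c, n⟩, l⟩
    · simp [pushB, stackWord, letter]
    by_cases hc : c = 0
    · subst hc
      simp only [pushB, stackWord, letter, map_mul, map_pow, if_true]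
      rw [mul_assoc, mul_assoc, ← mul_assoc (toMonoid a), toMonoid_alpha, mul_one]
    · simp [pushB, stackWord, letter, hc]
  | t =>
    simp only [step, stateWord, map_mul, map_pow]
    rw [mul_assoc _ (toMonoid x ^ k), ht, ← mul_assoc]
    congr 1
    rcases l with - | ⟨c, l⟩
    · simp [pushT, stackWord, letter]
    · simp only [pushT, stackWord, map_mul, map_pow, pow_succ, mul_assoc]
  | x => simp only [step, stateWord, map_mul, map_pow, pow_succ, mul_assoc]
  | y =>
    rcases k with - | k
    · simp [step, stateWord, stackWord, letter]
    · simp only [step, stateWord, map_mul, map_pow, pow_succ, mul_assoc, toMonoid_epsilon,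
        Nat.add_one_ne_zero, if_false, mul_one, Nat.add_sub_cancel]

theorem toMonoid_stateWord_run (s : State) (w : FreeMonoid SquierGen) :
    toMonoid (stateWord (run s w)) = toMonoid (stateWord s) * toMonoid w := by
  induction w using FreeMonoid.inductionOn' generalizing s with
  | one => simp
  | of_mul g w ih => rw [run_mul, ih, run_of, toMonoid_stateWord_step, map_mul, mul_assoc]

/-- The machine respects the relations, and conversely the word stored in the final state represents
the element read. -/
theorem toMonoid_eq_iff (u v : FreeMonoid SquierGen) :
    toMonoid u = toMonoid v ↔ run ([], 0) u = run ([], 0) v := by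
  refine ⟨fun h => run_eq_of_mk_eq h _, fun h => ?_⟩
  have hu := toMonoid_stateWord_run ([], 0) u
  have hv := toMonoid_stateWord_run ([], 0) v
  rw [h, hv] at hu
  simpa [stateWord, stackWord] using hu.symm

/-! ### The word problem -/

/-- A numbering of the generators. -/
def gen (i : Fin 5) : SquierGen :=
  if i = 0 then .a else if i = 1 then .b else if i = 2 then .t else if i = 3 then .x else .y

theorem gen_surjective : Function.Surjective gen := by
  rintro (_ | _ | _ | _ | _)
  exacts [⟨0, rfl⟩, ⟨1, rfl⟩, ⟨2, rfl⟩, ⟨3, rfl⟩, ⟨4, rfl⟩]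

open Primrec in
theorem primrec_pushT : Primrec pushT := by
  refine (list_casesOn (f := fun l : List (ℕ × ℕ) => l) (g := fun _ => [(3, 1)])
    (h := fun _ c => (c.1.1, c.1.2 + 1) :: c.2) .id (const _) ?_).of_eq ?_
  · exact list_cons.comp
      (.pair (fst.comp (fst.comp snd)) (succ.comp (snd.comp (fst.comp snd)))) (snd.comp snd)
  · rintro (_ | _) <;> rfl

open Primrec in
theorem primrec_pushB : Primrec pushB := by
  refine (list_casesOn (f := fun l : List (ℕ × ℕ) => l) (g := fun _ => [(1, 0)])
    (h := fun _ c => if c.1.1 = 0 then c.2 else (1, 0) :: c.1 :: c.2) .id (const _) ?_).of_eq ?_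
  · refine Primrec.ite ?_ (snd.comp snd)
      (list_cons.comp (const _) (list_cons.comp (fst.comp snd) (snd.comp snd)))
    exact Primrec.eq.comp (fst.comp (fst.comp snd)) (const 0)
  · rintro (_ | _) <;> rfl

open Primrec in
theorem primrec_step (g : SquierGen) : Primrec fun s => step s g := by
  cases g with
  | a => exact .pair (list_cons.comp (.pair (const 0) snd) fst) snd
  | b => exact .pair (primrec_pushB.comp fst) snd
  | t => exact .pair (primrec_pushT.comp fst) snd
  | x => exact .pair fst (succ.comp snd)
  | y =>
    exact Primrec.ite (Primrec.eq.comp snd (const 0))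
      (.pair (list_cons.comp (const _) fst) (const 0)) (.pair fst (pred.comp snd))

open Primrec in
theorem primrec_step_gen : Primrec fun z : State × Fin 5 => step z.1 (gen z.2) := by
  have h (g : SquierGen) : Primrec fun z : State × Fin 5 => step z.1 g :=
    (primrec_step g).comp fst
  have hi (i : Fin 5) : PrimrecPred fun z : State × Fin 5 => z.2 = i :=
    Primrec.eq.comp snd (const i)
  refine (Primrec.ite (hi 0) (h .a) (Primrec.ite (hi 1) (h .b) (Primrec.ite (hi 2) (h .t)
    (Primrec.ite (hi 3) (h .x) (h .y))))).of_eq fun z => ?_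
  simp only [gen]
  split_ifs <;> rfl

open Primrec in
theorem primrec_run : Primrec fun w : List (Fin 5) =>
    run ([], 0) (FreeMonoid.map gen (FreeMonoid.ofList w)) := by
  refine (list_foldl (f := fun w : List (Fin 5) => w) (g := fun _ => (([], 0) : State))
    (h := fun _ z => step z.1 (gen z.2)) .id (const _) (primrec_step_gen.comp snd)).of_eq
    fun w => ?_
  exact List.foldl_map.symm

theorem hasDecidableWordProblem : HasDecidableWordProblem SquierMonoid := by
  refine ⟨5, toMonoid.comp (FreeMonoid.map gen),
    PresentedMonoid.surjective_mk.comp (FreeMonoid.map_surjective.2 gen_surjective), ?_⟩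
  have h : PrimrecPred fun p : List (Fin 5) × List (Fin 5) =>
      run ([], 0) (FreeMonoid.map gen (FreeMonoid.ofList p.1)) =
        run ([], 0) (FreeMonoid.map gen (FreeMonoid.ofList p.2)) :=
    Primrec.eq.comp (primrec_run.comp .fst) (primrec_run.comp .snd)
  exact h.computablePred.of_eq fun p => (toMonoid_eq_iff _ _).symm

/-! ### A finite presentation -/

/-- The finite presentation of Squier's monoid obtained by keeping only the first of the relations
`a tⁿ b ⇒ 1`. -/
def finSq : MonoidPresentation.{0, 0} where
  Gen := SquierGen
  Rule := Fin 5
  src := fun i => src (![.alpha 0, .beta, .gamma, .delta, .epsilon] i)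
  tgt := fun i => tgt (![.alpha 0, .beta, .gamma, .delta, .epsilon] i)

/-- The relations `a tⁿ b ⇒ 1` follow from the other relations and from `a b ⇒ 1`. -/
theorem map_src_eq_map_tgt {N : Type*} [Monoid N] (m : FreeMonoid SquierGen →* N)
    (hα : m (src (.alpha 0)) = m (tgt (.alpha 0))) (hβ : m (src .beta) = m (tgt .beta))
    (hγ : m (src .gamma) = m (tgt .gamma)) (hδ : m (src .delta) = m (tgt .delta))
    (hε : m (src .epsilon) = m (tgt .epsilon)) (r : SquierRule) : m (src r) = m (tgt r) := by
  cases r with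
  | alpha n =>
    induction n with
    | zero => exact hα
    | succ n ih =>
      simp only [src, tgt, map_mul, map_one, map_pow] at hβ hγ hδ hε ih ⊢
      have hc : m x * m t ^ n = m t ^ n * m x :=
        (show Commute (m x) (m t) from hγ).pow_right n
      -- Insert `x y = 1` on the right and move `x` to the far left; crossing `a` absorbs one `t`.
      calc m a * m t ^ (n + 1) * m b = m a * m t * m t ^ n * m b * (m x * m y) := by
            rw [hε, mul_one, pow_succ']; simp only [mul_assoc]
        _ = m a * m t * m t ^ n * (m b * m x) * m y := by simp only [mul_assoc]
        _ = m a * m t * (m t ^ n * m x) * m b * m y := by rw [← hδ]; simp only [mul_assoc]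
        _ = m a * m t * m x * m t ^ n * m b * m y := by rw [← hc]; simp only [mul_assoc]
        _ = m x * (m a * m t ^ n * m b) * m y := by rw [← hβ]; simp only [mul_assoc]
        _ = 1 := by rw [ih, mul_one, hε]
  | beta => exact hβ
  | gamma => exact hγ
  | delta => exact hδ
  | epsilon => exact hε

theorem finSq_mk_src (r : SquierRule) :
    PresentedMonoid.mk finSq.Rel (src r) = PresentedMonoid.mk finSq.Rel (tgt r) :=
  have h (i : Fin 5) := MonoidPresentation.mk_src_eq_mk_tgt (P := finSq) i
  map_src_eq_map_tgt (PresentedMonoid.mk finSq.Rel) (h 0) (h 1) (h 2) (h 3) (h 4) r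

theorem finitelyPresented : MonoidFinitelyPresented SquierMonoid := by
  refine ⟨finSq, ⟨?_, inferInstanceAs (Finite (Fin 5))⟩, ⟨?_⟩⟩
  · exact Finite.of_surjective gen gen_surjective
  · refine Con.congr (MulEquiv.refl (FreeMonoid SquierGen)) (le_antisymm ?_ ?_)
    · refine Con.conGen_le.2 ?_
      rintro _ _ ⟨i, rfl, rfl⟩
      exact ConGen.Rel.of _ _ ⟨![.alpha 0, .beta, .gamma, .delta, .epsilon] i, rfl, rfl⟩
    · intro u v (h : conGen Sq.Rel u v)
      have : conGen Sq.Rel ≤ conGen finSq.Rel := by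
        refine Con.conGen_le.2 ?_
        rintro _ _ ⟨r, rfl, rfl⟩
        exact PresentedMonoid.mk_eq_mk_iff.1 (finSq_mk_src r)
      exact this h

end Squier

theorem MonoidPresentation.map_eq_of_mk_eq {P : MonoidPresentation.{u, v}} {N : Type*} [Monoid N]
    (m : FreeMonoid P.Gen →* N) (h : ∀ r, m (P.src r) = m (P.tgt r)) {w w' : FreeMonoid P.Gen}
    (hw : PresentedMonoid.mk P.Rel w = PresentedMonoid.mk P.Rel w') : m w = m w' := by
  have hw' := eqvGen_step_of_mk_eq hw
  clear hw
  induction hw' with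
  | rel _ _ h' =>
    obtain ⟨p, q, r, rfl, rfl⟩ := h'
    simp only [map_mul, h]
  | refl _ => rfl
  | symm _ _ _ ih => exact ih.symm
  | trans _ _ _ _ _ ih ih' => exact ih.trans ih'

namespace Squier

open Filter MulOpposite

/-! ### Right actions on abelian groups of sequences -/

section RightAction

variable {D : Type*} [AddCommGroup D]

/-- The right action of words for which `x` and `y` act by `X` and `Y`, and `a`, `b`, `t` act
trivially. -/
def rightAction (X Y : AddMonoid.End D) : FreeMonoid SquierGen →* (AddMonoid.End D)ᵐᵒᵖ :=
  FreeMonoid.lift fun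
    | .x => op X
    | .y => op Y
    | _ => 1

variable (X Y : AddMonoid.End D)

@[simp] theorem rightAction_a : rightAction X Y a = 1 := rfl
@[simp] theorem rightAction_b : rightAction X Y b = 1 := rfl
@[simp] theorem rightAction_t : rightAction X Y t = 1 := rfl
@[simp] theorem rightAction_x : rightAction X Y x = op X := rfl
@[simp] theorem rightAction_y : rightAction X Y y = op Y := rfl

variable {X Y}

theorem rightAction_src (h : Y * X = 1) (r : SquierRule) :
    rightAction X Y (src r) = rightAction X Y (tgt r) := by
  cases r <;> simp [src, tgt, ← op_mul, h]

theorem rightAction_eq_of_toMonoid_eq (h : Y * X = 1) {u v : FreeMonoid SquierGen}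
    (huv : toMonoid u = toMonoid v) : rightAction X Y u = rightAction X Y v :=
  MonoidPresentation.map_eq_of_mk_eq (P := Sq) _ (rightAction_src h) huv

end RightAction

/-- Translation of bi-infinite sequences. -/
def shift (h : ℤ) : AddMonoid.End (ℤ → ℤ) where
  toFun f i := f (i - h)
  map_zero' := rfl
  map_add' _ _ := rfl

theorem shift_apply (h : ℤ) (f : ℤ → ℤ) (i : ℤ) : shift h f i = f (i - h) := rfl

theorem shift_single (h j : ℤ) : shift h (Pi.single j 1) = Pi.single (j + h) 1 := by
  ext i
  simp only [shift_apply, Pi.single_apply, sub_eq_iff_eq_add]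

theorem shift_neg_one_mul_shift_one : shift (-1) * shift 1 = 1 := by
  ext f i
  simp [shift_apply]

/-- The right action on bi-infinite sequences. -/
abbrev translate : FreeMonoid SquierGen →* (AddMonoid.End (ℤ → ℤ))ᵐᵒᵖ :=
  rightAction (shift 1) (shift (-1))

/-- The sequences `ℤ → ℤ` which vanish near `-∞`. -/
def vanishing : AddSubgroup (ℤ → ℤ) where
  carrier := {f | ∀ᶠ i in atBot, f i = 0}
  zero_mem' := by simp
  add_mem' hf hg := by filter_upwards [hf, hg] with i h₁ h₂; simp [h₁, h₂]
  neg_mem' hf := by filter_upwards [hf] with i h; simp [h]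

theorem shift_mem_vanishing {f : ℤ → ℤ} (hf : f ∈ vanishing) (h : ℤ) : shift h f ∈ vanishing :=
  (tendsto_atBot_add_const_right atBot (-h) tendsto_id).eventually hf

theorem translate_mem_vanishing {f : ℤ → ℤ} (hf : f ∈ vanishing) (w : FreeMonoid SquierGen) :
    (translate w).unop f ∈ vanishing := by
  induction w using FreeMonoid.inductionOn' generalizing f with
  | one => simpa using hf
  | of_mul g w ih =>
    rw [MonoidPresentation.unop_map_mul]
    refine ih ?_
    cases g
    exacts [hf, hf, hf, shift_mem_vanishing hf 1, shift_mem_vanishing hf (-1)]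

theorem single_mem_vanishing (j c : ℤ) : Pi.single j c ∈ vanishing := by
  filter_upwards [eventually_lt_atBot j] with i hi
  rw [Pi.single_apply, if_neg hi.ne]

/-- Prepend a zero to a sequence. -/
def prepend : AddMonoid.End (ℕ → ℤ) where
  toFun f i := i.casesOn 0 f
  map_zero' := by ext (_ | _) <;> rfl
  map_add' _ _ := by ext (_ | _) <;> rfl

/-- Drop the first term of a sequence. -/
def drop : AddMonoid.End (ℕ → ℤ) where
  toFun f i := f (i + 1)
  map_zero' := rfl
  map_add' _ _ := rfl

/-- Only `x y = 1` has to hold. The other composite erases the first term, and this failure is what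
truncation exploits. -/
theorem drop_mul_prepend : drop * prepend = 1 := rfl

/-- The right action on sequences. -/
abbrev act : FreeMonoid SquierGen →* (AddMonoid.End (ℕ → ℤ))ᵐᵒᵖ :=
  rightAction prepend drop

/-- The terms of index at least `-N` of a bi-infinite sequence. -/
def restrict (N : ℕ) : (ℤ → ℤ) →+ (ℕ → ℤ) where
  toFun f i := f (i - N)
  map_zero' := rfl
  map_add' _ _ := rfl

/-- The two sides differ only in their first term, `0` against the value of `f` at `-N - 1`. -/
theorem eventually_prepend_restrict {f : ℤ → ℤ} (hf : f ∈ vanishing) :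
    ∀ᶠ N in atTop, prepend (restrict N f) = restrict N (shift 1 f) := by
  have h : Tendsto (fun N : ℕ => -1 + -(N : ℤ)) atTop atBot :=
    tendsto_atBot_add_const_left _ _ (tendsto_neg_atTop_atBot.comp tendsto_natCast_atTop_atTop)
  filter_upwards [h.eventually hf] with N hN
  ext (_ | i)
  · refine hN.symm.trans (congrArg f ?_)
    push_cast
    ring
  · refine congrArg f ?_
    push_cast
    ring

theorem drop_restrict (f : ℤ → ℤ) (N : ℕ) : drop (restrict N f) = restrict N (shift (-1) f) := by
  ext i
  refine congrArg f ?_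
  push_cast
  ring

theorem eventually_act_restrict {f : ℤ → ℤ} (hf : f ∈ vanishing) (w : FreeMonoid SquierGen) :
    ∀ᶠ N in atTop, (act w).unop (restrict N f) = restrict N ((translate w).unop f) := by
  induction w using FreeMonoid.inductionOn' generalizing f with
  | one => simp
  | of_mul g w ih =>
    simp only [MonoidPresentation.unop_map_mul]
    cases g with
    | a => exact ih hf
    | b => exact ih hf
    | t => exact ih hf
    | x =>
      filter_upwards [eventually_prepend_restrict hf, ih (shift_mem_vanishing hf 1)] with N h₁ h₂
      exact (congrArg _ h₁).trans h₂
    | y =>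
      filter_upwards [ih (shift_mem_vanishing hf (-1))] with N h
      exact (congrArg _ (drop_restrict f N)).trans h

/-! ### The bi-infinite potential -/

/-- The weight produced by the machine when it reads a letter: erasing a factor `a tⁿ b` on the
left of `x ^ k` has a weight concentrated in degree `k - n`. -/
def pulse (s : State) : SquierGen → ℤ → ℤ
  | .b => if s.1.head?.map Prod.fst = some 0 then Pi.single (s.2 - (s.1.headD 0).2) 1 else 0
  | _ => 0

/-- The total weight produced by the machine when it reads a list of letters. -/
def emitList (s : State) : List SquierGen → ℤ → ℤ
  | [] => 0
  | g :: w => (translate (FreeMonoid.ofList w)).unop (pulse s g) + emitList (step s g) w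

/-- The total weight produced by the machine when it reads a word. -/
def emit (s : State) (w : FreeMonoid SquierGen) : ℤ → ℤ :=
  emitList s w.toList

theorem emit_one (s : State) : emit s 1 = 0 := rfl

theorem emit_of_mul (s : State) (g : SquierGen) (w : FreeMonoid SquierGen) :
    emit s (FreeMonoid.of g * w) = (translate w).unop (pulse s g) + emit (step s g) w := rfl

theorem emit_of (s : State) (g : SquierGen) : emit s (FreeMonoid.of g) = pulse s g := by
  simpa [emit_one] using emit_of_mul s g 1

theorem emit_mul (s : State) (u v : FreeMonoid SquierGen) :
    emit s (u * v) = (translate v).unop (emit s u) + emit (run s u) v := by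
  induction u using FreeMonoid.inductionOn' generalizing s with
  | one => simp [emit_one]
  | of_mul g u ih =>
    rw [mul_assoc, emit_of_mul, ih, emit_of_mul, run_mul, run_of,
      MonoidPresentation.unop_map_mul, map_add, add_assoc]

theorem emit_t_pow (s : State) (n : ℕ) : emit s (t ^ n) = 0 := by
  induction n with
  | zero => rfl
  | succ n ih => rw [pow_succ, emit_mul, ih, emit_of, map_zero, zero_add]; rfl

theorem emit_mem_vanishing (s : State) (w : FreeMonoid SquierGen) : emit s w ∈ vanishing := by
  induction w using FreeMonoid.inductionOn' generalizing s with
  | one => exact vanishing.zero_mem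
  | of_mul g w ih =>
    rw [emit_of_mul]
    refine vanishing.add_mem (translate_mem_vanishing ?_ w) (ih _)
    cases g
    case b =>
      simp only [pulse]
      split_ifs
      exacts [single_mem_vanishing _ _, vanishing.zero_mem]
    all_goals exact vanishing.zero_mem

/-- The weight of a relation. -/
def ruleWeight : SquierRule → ℤ → ℤ
  | .alpha n => Pi.single (-n) 1
  | _ => 0

/-- One more `x` to the right of the erased factor raises the degree by one, as required by `x b ⇒ b
x`. -/
theorem pulse_x_b (s : State) : pulse (step s .x) .b = shift 1 (pulse s .b) := by
  obtain ⟨_ | ⟨⟨_ | c, n⟩, l⟩, k⟩ := s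
  · simp [pulse, step]
  · simp only [pulse, step, List.head?_cons, Option.map_some, List.headD_cons, if_true,
      shift_single]
    congr 1
    push_cast
    ring
  · simp [pulse, step]

theorem emit_src (s : State) (r : SquierRule) :
    emit s (src r) = ruleWeight r + emit s (tgt r) := by
  cases r with
  | alpha n =>
    -- From a state with `k` trailing `x`s, reading `a tⁿ` stores `a tⁿ⁺ᵏ`, so `b` emits in degree
    -- `k - (n + k) = -n`, whatever the state.
    simp only [src, tgt, emit_mul, emit_of, emit_t_pow, emit_one, run_mul, run_of, step, run_t_pow]
    simp [pulse, ruleWeight]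
  | beta => simp [src, tgt, emit_mul, emit_of, pulse, ruleWeight]
  | gamma => simp [src, tgt, emit_mul, emit_of, pulse, ruleWeight]
  | delta =>
    simp only [src, tgt, emit_mul, emit_of, run_of, pulse_x_b, rightAction_x, unop_op,
      rightAction_b, unop_one, AddMonoid.End.one_apply, ruleWeight]
    simp [pulse]
  | epsilon => simp [src, tgt, emit_mul, emit_of, emit_one, pulse, ruleWeight]

/-- The potential given by the weight that the machine produces from its initial state. -/
def potential (w : FreeMonoid SquierGen) : ℤ → ℤ :=
  emit ([], 0) w

theorem isPotential_potential : Sq.IsPotential translate ruleWeight potential := by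
  intro (p : FreeMonoid SquierGen) (q : FreeMonoid SquierGen) (r : SquierRule)
  change emit ([], 0) (p * src r * q) - emit ([], 0) (p * tgt r * q) = _
  simp only [emit_mul, run_mul, emit_src, run_src, map_add,
    rightAction_src shift_neg_one_mul_shift_one]
  abel

theorem potential_sub_mem_vanishing (u v : FreeMonoid SquierGen) :
    potential u - potential v ∈ vanishing :=
  vanishing.sub_mem (emit_mem_vanishing _ _) (emit_mem_vanishing _ _)

theorem potential_src_sub_tgt (r : SquierRule) :
    potential (src r) - potential (tgt r) = ruleWeight r := by
  simp [potential, emit_src]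

theorem potential_sub_eq {u v : FreeMonoid SquierGen} (h : toMonoid u = toMonoid v)
    (p q : FreeMonoid SquierGen) :
    potential (p * u * q) - potential (p * v * q) =
      (translate q).unop (potential u - potential v) :=
  isPotential_potential.sub_eq h p q

/-! ### Weights on another presentation -/

section Transfer

variable {P : MonoidPresentation.{u, v}} (φ : FreeMonoid P.Gen →* FreeMonoid SquierGen)

/-- The weights of the rules of `P` obtained from the potential on words over the generators of
Squier's monoid, truncated in degrees less than `-N`. -/
def transferWeight (N : ℕ) (r : P.Rule) : ℕ → ℤ :=
  restrict N (potential (φ (P.src r)) - potential (φ (P.tgt r)))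

variable {φ} (hφ : ∀ r, toMonoid (φ (P.src r)) = toMonoid (φ (P.tgt r)))
include hφ

theorem eventually_act_transferWeight (p q : FreeMonoid P.Gen) (r : P.Rule) :
    ∀ᶠ N in atTop, (act.comp φ q).unop (transferWeight φ N r) =
      restrict N (potential (φ (p * P.src r * q)) - potential (φ (p * P.tgt r * q))) := by
  simp only [map_mul φ, potential_sub_eq (hφ r)]
  exact eventually_act_restrict (potential_sub_mem_vanishing _ _) (φ q)

theorem eventually_reflTransGen_weightStep {w w' : FreeMonoid P.Gen} (h : P.Rewrites w w') :
    ∀ᶠ N in atTop, ∀ d, Relation.ReflTransGen (P.WeightStep (act.comp φ) (transferWeight φ N))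
      (w, d) (w', d + restrict N (potential (φ w) - potential (φ w'))) := by
  induction h with
  | refl =>
    refine Eventually.of_forall fun N d => ?_
    simp only [sub_self, map_zero, add_zero]
    exact .refl
  | tail _ h ih =>
    obtain ⟨p, q, r, rfl, rfl⟩ := h
    filter_upwards [ih, eventually_act_transferWeight hφ p q r] with N h₁ h₂ d
    refine (h₁ d).tail ⟨p, q, r, rfl, rfl, ?_⟩
    simp only [h₂, add_assoc, ← map_add, sub_add_sub_cancel]

/-- Before truncation, both resolutions of a branching have total weight the drop of potential from
its source to the common word. Each resolution is finite, so this persists for large `N`; finiteness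
of the presentation makes one `N` serve all bounded contexts. -/
theorem eventually_criticallyConsistent (hfin : P.IsFinite) (hconf : P.Confluent) (L : ℕ) :
    ∀ᶠ N in atTop, P.CriticallyConsistent (act.comp φ) (transferWeight φ N) L := by
  have := hfin.1
  have := hfin.2
  have hS : {w : FreeMonoid P.Gen | w.length ≤ L}.Finite := List.finite_length_le P.Gen L
  have key (p q p' q' : FreeMonoid P.Gen) (r r' : P.Rule) :
      ∀ᶠ N in atTop, p * P.src r * q = p' * P.src r' * q' →
        Relation.Join
          (Relation.ReflTransGen (P.WeightStep (act.comp φ) (transferWeight φ N)))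
          (p * P.tgt r * q, (act.comp φ q).unop (transferWeight φ N r))
          (p' * P.tgt r' * q', (act.comp φ q').unop (transferWeight φ N r')) := by
    by_cases hw : p * P.src r * q = p' * P.src r' * q'
    · obtain ⟨v, hv, hv'⟩ := hconf (p * P.src r * q) _ _ (.single ⟨p, q, r, rfl, rfl⟩)
        (.single ⟨p', q', r', hw, rfl⟩)
      filter_upwards [eventually_reflTransGen_weightStep hφ hv,
        eventually_reflTransGen_weightStep hφ hv', eventually_act_transferWeight hφ p q r,
        eventually_act_transferWeight hφ p' q' r'] with N h₁ h₂ h₃ h₄ _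
      refine ⟨(v, restrict N (potential (φ (p * P.src r * q)) - potential (φ v))), ?_, ?_⟩
      · have := h₁ ((act.comp φ q).unop (transferWeight φ N r))
        rwa [h₃, ← map_add, sub_add_sub_cancel, ← h₃] at this
      · have := h₂ ((act.comp φ q').unop (transferWeight φ N r'))
        rwa [h₄, ← map_add, sub_add_sub_cancel, ← h₄, ← hw] at this
    · exact Eventually.of_forall fun N h => absurd h hw
  have key' : ∀ᶠ N in atTop, ∀ p ∈ {w : FreeMonoid P.Gen | w.length ≤ L},
      ∀ q ∈ {w : FreeMonoid P.Gen | w.length ≤ L}, ∀ p' ∈ {w : FreeMonoid P.Gen | w.length ≤ L},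
      ∀ q' ∈ {w : FreeMonoid P.Gen | w.length ≤ L}, ∀ r r' : P.Rule,
      p * P.src r * q = p' * P.src r' * q' →
        Relation.Join
          (Relation.ReflTransGen (P.WeightStep (act.comp φ) (transferWeight φ N)))
          (p * P.tgt r * q, (act.comp φ q).unop (transferWeight φ N r))
          (p' * P.tgt r' * q', (act.comp φ q').unop (transferWeight φ N r')) := by
    simp only [eventually_all_finite hS]
    intro p _ q _ p' _ q' _
    exact eventually_all.2 fun r => eventually_all.2 fun r' => key p q p' q' r r'
  filter_upwards [key'] with N h p q p' q' r r' hp hq hp' hq'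
  exact h p hp q hq p' hp' q' hq' r r'

theorem eventually_exists_isPotential (hfin : P.IsFinite) (hconv : P.Convergent) :
    ∀ᶠ N in atTop, ∃ Ψ, P.IsPotential (act.comp φ) (transferWeight φ N) Ψ := by
  have := hfin.2
  obtain ⟨L, hL⟩ := (Set.finite_range fun r => (P.src r).length).bddAbove
  filter_upwards [eventually_criticallyConsistent hφ hfin hconv.2 L] with N h
  exact MonoidPresentation.exists_isPotential hconv.1
    (fun r => rightAction_eq_of_toMonoid_eq drop_mul_prepend (hφ r))
    (fun r => hL ⟨r, rfl⟩) h

/-- The bound on `N` depends on the zigzag joining the two words, so it is not uniform over all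
pairs. -/
theorem eventually_isPotential_sub_eq {w w' : FreeMonoid P.Gen}
    (h : PresentedMonoid.mk P.Rel w = PresentedMonoid.mk P.Rel w') :
    ∀ᶠ N in atTop, ∀ Ψ, P.IsPotential (act.comp φ) (transferWeight φ N) Ψ →
      Ψ w - Ψ w' = restrict N (potential (φ w) - potential (φ w')) := by
  have h' := MonoidPresentation.eqvGen_step_of_mk_eq h
  clear h
  induction h' with
  | rel _ _ h =>
    obtain ⟨p, q, r, rfl, rfl⟩ := h
    filter_upwards [eventually_act_transferWeight hφ p q r] with N h Ψ hΨ
    rw [hΨ p q r, h]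
  | refl _ => simp
  | symm _ _ _ ih =>
    filter_upwards [ih] with N h Ψ hΨ
    rw [← neg_sub, h Ψ hΨ, ← map_neg, neg_sub]
  | trans _ _ _ _ _ ih ih' =>
    filter_upwards [ih, ih'] with N h h' Ψ hΨ
    rw [← sub_add_sub_cancel, h Ψ hΨ, h' Ψ hΨ, ← map_add, sub_add_sub_cancel]

end Transfer

/-! ### The obstruction -/

theorem toMonoid_x_t_pow (n : ℕ) : toMonoid (x * t ^ n) = toMonoid (t ^ n * x) := by
  rw [map_mul, map_mul, map_pow]
  exact (show Commute (toMonoid x) (toMonoid t) from toMonoid_gamma).pow_right n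

/-- A function on words varies along congruences compatibly with the right action. -/
def IsEquivariant (Θ : FreeMonoid SquierGen → ℕ → ℤ) : Prop :=
  ∀ u v, toMonoid u = toMonoid v → ∀ p q,
    Θ (p * u * q) - Θ (p * v * q) = (act q).unop (Θ u - Θ v)

theorem act_t_pow (n : ℕ) : act (t ^ n) = 1 := by
  rw [map_pow, rightAction_t, one_pow]

theorem IsEquivariant.x_t_pow {Θ : FreeMonoid SquierGen → ℕ → ℤ} (hΘ : IsEquivariant Θ) (n : ℕ) :
    Θ (x * t ^ n) - Θ (t ^ n * x) = n • (Θ (x * t) - Θ (t * x)) := by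
  induction n with
  | zero => simp
  | succ n ih =>
    have h₁ := hΘ _ _ (toMonoid_x_t_pow n) 1 t
    have h₂ := hΘ _ _ (toMonoid_src .gamma) (t ^ n) 1
    simp only [src, tgt, one_mul, mul_one, rightAction_t, map_one, unop_one,
      AddMonoid.End.one_apply, ih] at h₁ h₂
    rw [succ_nsmul, ← h₁, ← h₂, pow_succ]
    simp only [mul_assoc]
    abel

/-- The two ways of reducing `x a tⁿ b`. -/
theorem IsEquivariant.alpha_eq {Θ : FreeMonoid SquierGen → ℕ → ℤ} (hΘ : IsEquivariant Θ) (n : ℕ) :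
    Θ (src (.alpha n)) - Θ 1 =
      (Θ (x * a) - Θ (a * t * x)) + n • (Θ (x * t) - Θ (t * x)) + (Θ (x * b) - Θ (b * x)) +
        prepend (Θ (src (.alpha (n + 1))) - Θ 1) := by
  -- `h₀` erases `a tⁿ b` directly; `h₁` to `h₄` first carry `x` across `a`, `tⁿ` and `b`, then
  -- erase `a tⁿ⁺¹ b` to the left of `x`.
  have h₀ := hΘ _ _ (toMonoid_src (.alpha n)) x 1
  have h₁ := hΘ _ _ (toMonoid_src .beta) 1 (t ^ n * b)
  have h₂ := hΘ _ _ (toMonoid_x_t_pow n) (a * t) b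
  have h₃ := hΘ _ _ (toMonoid_src .delta) (a * t ^ (n + 1)) 1
  have h₄ := hΘ _ _ (toMonoid_src (.alpha (n + 1))) 1 x
  simp only [src, tgt, one_mul, mul_one, map_mul act, act_t_pow, rightAction_b, rightAction_x,
    map_one, unop_one, unop_op, AddMonoid.End.one_apply, hΘ.x_t_pow] at h₀ h₁ h₂ h₃ h₄ ⊢
  rw [← h₀, ← h₁, ← h₂, ← h₃, ← h₄, pow_succ']
  simp only [mul_assoc]
  abel

/-- Term `i` of `z n` is the first term of `z (n + i)`, which is a prepended zero. -/
theorem eq_zero_of_eq_prepend {z : ℕ → ℕ → ℤ} (h : ∀ n, z n = prepend (z (n + 1))) (n : ℕ) :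
    z n = 0 := by
  ext i
  induction i generalizing n with
  | zero => rw [h]; rfl
  | succ i ih => rw [h]; exact ih (n + 1)

section Discrepancy

variable (κ : FreeMonoid SquierGen →* FreeMonoid SquierGen)

/-- The variation of the potential under an endomorphism. -/
def discrepancy (w : FreeMonoid SquierGen) : ℤ → ℤ :=
  potential (κ w) - potential w

variable {κ} (hκ : ∀ w, toMonoid (κ w) = toMonoid w)

theorem discrepancy_one : discrepancy κ 1 = 0 := by
  simp [discrepancy]

include hκ

/-- A derivation rule: `κ v` and `v` act alike. It makes the correction for `a tⁿ b` affine in `n`,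
as `a`, `b`, `t` act trivially. -/
theorem discrepancy_mul (u v : FreeMonoid SquierGen) :
    discrepancy κ (u * v) = (translate v).unop (discrepancy κ u) + discrepancy κ v := by
  have h₁ := potential_sub_eq (hκ u) 1 (κ v)
  have h₂ := potential_sub_eq (hκ v) u 1
  rw [rightAction_eq_of_toMonoid_eq shift_neg_one_mul_shift_one (hκ v)] at h₁
  simp only [one_mul, mul_one, map_one, unop_one, AddMonoid.End.one_apply] at h₁ h₂
  simp only [discrepancy, ← h₁, ← h₂, map_mul, sub_add_sub_cancel]

/-- No equivariant function is the truncation of the transported potential on the relations. -/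
theorem not_isEquivariant {Θ : FreeMonoid SquierGen → ℕ → ℤ} (hΘ : IsEquivariant Θ) {N : ℕ}
    (hab : prepend (restrict N (discrepancy κ a + discrepancy κ b)) =
      restrict N (shift 1 (discrepancy κ a + discrepancy κ b)))
    (ht : prepend (restrict N (discrepancy κ t)) = restrict N (shift 1 (discrepancy κ t)))
    (h : ∀ r ∈ [SquierRule.alpha 0, .beta, .gamma, .delta], Θ (src r) - Θ (tgt r) =
      restrict N (potential (κ (src r)) - potential (κ (tgt r)))) : False := by
  have h' (r) (hr : r ∈ [SquierRule.alpha 0, .beta, .gamma, .delta]) :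
      Θ (src r) - Θ (tgt r) =
        restrict N (ruleWeight r + discrepancy κ (src r) - discrepancy κ (tgt r)) := by
    rw [h r hr, ← potential_src_sub_tgt]
    simp only [discrepancy]
    congr 1
    abel
  have hα := h' (.alpha 0) (by simp)
  have hβ := h' .beta (by simp)
  have hγ := h' .gamma (by simp)
  have hδ := h' .delta (by simp)
  simp only [src, tgt, ruleWeight, discrepancy_mul hκ, discrepancy_one, rightAction_a,
    rightAction_b, rightAction_t, rightAction_x, unop_one, unop_op, AddMonoid.End.one_apply,
    pow_zero, mul_one, sub_zero, zero_add] at hβ hγ hδ hα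
  -- Subtracting the discrepancy of `a tⁿ b` cancels the contributions of the other three rules to
  -- the recurrence.
  have hz := eq_zero_of_eq_prepend (z := fun n => Θ (src (.alpha n)) - Θ 1 -
    restrict N (discrepancy κ a + discrepancy κ b + n • discrepancy κ t)) (fun n => ?_) 0
  · have hN := congrFun hz N
    -- What remains at `n = 0` is the truncation of `e₀`, whose term of index `N` is `1`.
    simp only [src, pow_zero, mul_one, hα, zero_smul, add_zero, ← map_sub,
      add_sub_cancel_right] at hN
    simp [restrict] at hN
  · simp only [hΘ.alpha_eq n, hβ, hγ, hδ, map_sub, map_add, map_nsmul, succ_nsmul, ht]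
    simp only [map_add] at hab
    rw [hab]
    simp only [smul_sub, smul_add]
    abel

end Discrepancy

theorem not_convergent {P : MonoidPresentation.{u, v}} (hfin : P.IsFinite)
    (hP : P.Presents SquierMonoid) : ¬ P.Convergent := by
  intro hconv
  obtain ⟨e⟩ := hP
  choose f hf using fun g : P.Gen =>
    PresentedMonoid.surjective_mk (e (PresentedMonoid.mk P.Rel (FreeMonoid.of g)))
  choose f' hf' using fun g : SquierGen =>
    PresentedMonoid.surjective_mk (e.symm (toMonoid (FreeMonoid.of g)))
  set φ : FreeMonoid P.Gen →* FreeMonoid SquierGen := FreeMonoid.lift f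
  set ψ : FreeMonoid SquierGen →* FreeMonoid P.Gen := FreeMonoid.lift f'
  have hφ (w) : toMonoid (φ w) = e (PresentedMonoid.mk P.Rel w) :=
    DFunLike.congr_fun (FreeMonoid.hom_eq (f := toMonoid.comp φ)
      (g := e.toMonoidHom.comp (PresentedMonoid.mk P.Rel)) hf) w
  have hψ (w) : PresentedMonoid.mk P.Rel (ψ w) = e.symm (toMonoid w) :=
    DFunLike.congr_fun (FreeMonoid.hom_eq (f := (PresentedMonoid.mk P.Rel).comp ψ)
      (g := e.symm.toMonoidHom.comp toMonoid) hf') w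
  have hκ (w) : toMonoid (φ.comp ψ w) = toMonoid w := by
    rw [MonoidHom.comp_apply, hφ, hψ, MulEquiv.apply_symm_apply]
  have hφ' (r) : toMonoid (φ (P.src r)) = toMonoid (φ (P.tgt r)) := by
    rw [hφ, hφ, MonoidPresentation.mk_src_eq_mk_tgt]
  have hψ' {u v : FreeMonoid SquierGen} (h : toMonoid u = toMonoid v) :
      PresentedMonoid.mk P.Rel (ψ u) = PresentedMonoid.mk P.Rel (ψ v) := by
    rw [hψ, hψ, h]
  have hmem (w) : discrepancy (φ.comp ψ) w ∈ vanishing := potential_sub_mem_vanishing _ _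
  -- Four rules suffice, so a common `N` exists; the recurrence reaches all the other `a tⁿ b`.
  have hrule : ∀ᶠ N in atTop, ∀ r ∈ {r | r ∈ [SquierRule.alpha 0, .beta, .gamma, .delta]},
      ∀ Ψ, P.IsPotential (act.comp φ) (transferWeight φ N) Ψ →
        Ψ (ψ (src r)) - Ψ (ψ (tgt r)) =
          restrict N (potential (φ (ψ (src r))) - potential (φ (ψ (tgt r)))) :=
    (eventually_all_finite (List.finite_toSet _)).2 fun r _ =>
      eventually_isPotential_sub_eq hφ' (hψ' (toMonoid_src r))
  obtain ⟨N, ⟨Ψ, hΨ⟩, hab, ht, hr⟩ := ((eventually_exists_isPotential hφ' hfin hconv).and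
    ((eventually_prepend_restrict (vanishing.add_mem (hmem a) (hmem b))).and
    ((eventually_prepend_restrict (hmem t)).and hrule))).exists
  refine not_isEquivariant hκ (Θ := fun w => Ψ (ψ w)) (fun u v h p q => ?_) hab ht
    fun r h => hr r h Ψ hΨ
  simp only [map_mul ψ]
  rw [hΨ.sub_eq (hψ' h)]
  exact congrArg (fun m => m.unop (Ψ (ψ u) - Ψ (ψ v)))
    (rightAction_eq_of_toMonoid_eq drop_mul_prepend (hκ q))

end Squier

theorem corollary6p2p7 :
    MonoidFinitelyPresented SquierMonoid ∧
    HasDecidableWordProblem SquierMonoid ∧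
    ∀ P : MonoidPresentation.{u, v}, P.IsFinite → P.Presents SquierMonoid → ¬ P.Convergent :=
  ⟨Squier.finitelyPresented, Squier.hasDecidableWordProblem, fun _ => Squier.not_convergent⟩
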